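/- For an integer $n\ge 1$ let $\mathrm{Conf}_n(\mathbb C)$ be the space of $n$-element subsets of $\mathbb C$ (a quotient of the space of ordered $n$-tuples of distinct complex numbers), and for $s\in \mathrm{Conf}_n(\mathbb C)$ let $B_n=\pi_1(\mathrm{Conf}_n(\mathbb C),s)$ be the braid group with base configuration $s$; products are read from left to right (the left factor is run through first). Order the points of $s$ from left to right by their real parts, after a clockwise rotation of the plane by a small angle $\theta>0$ if some real parts coincide, and let $\sigma_i\in B_n$ be the positive (counterclockwise) half-twist that exchanges the $i$-th and the $(i+1)$-st point. Let $S\subset\mathbb C^2$ be the curve $y(y^3-x^2)=0$ and let $K(x)=\{y\in\mathbb C : (x,y)\in S\}$. The set $N=\{x\in\mathbb C : |K(x)|<4\}$ is $\{0\}$. Let $r>0$ and $E=\{x\in\mathbb C : |x|\le r\}$. The local braid monodromy of $S$ at the origin is the homomorphism $\varphi:\pi_1(E\setminus\{0\},r)\to B_4=\pi_1(\mathrm{Conf}_4(\mathbb C),K(r))$ induced by $x\mapsto K(x)$; that is, it sends the class of a loop to the braid formed by the second coordinates of the four lifts of the loop to $S$. **Proposition.** Let $\Gamma$ be the loop $t\mapsto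 re^{2\pi i t}$, $t\in[0,1]$. Then for all sufficiently small $\theta>0$, $$\varphi([\Gamma])=(\sigma_1\sigma_2\sigma_3\sigma_2)^2\in B_4,$$ and the image of $\varphi$ is the subgroup of $B_4$ generated by $(\sigma_1\sigma_2\sigma_3\sigma_2)^2$. -/

import Mathlib

open Polynomial Topology Set
open scoped Polynomial.Bivariate

noncomputable section

namespace BraidMonodromy

/-! ### The braid group as the fundamental group of a configuration space -/

/-- The fundamental group `π₁(T, x)` in which the product of two loops is their concatenation,
the left factor being run through first. (Mathlib's `FundamentalGroup` uses the opposite order.) -/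
abbrev Pi1 (T : Type*) [TopologicalSpace T] (x : T) : Type _ :=
  (FundamentalGroup T x)ᵐᵒᵖ

/-- The class of a loop in the fundamental group. -/
def loopClass {T : Type*} [TopologicalSpace T] {x : T} (γ : Path x x) : Pi1 T x :=
  MulOpposite.op (FundamentalGroup.fromPath (Path.Homotopic.Quotient.mk γ))

/-- The homomorphism induced on fundamental groups by a continuous map. -/
def Pi1.map {T Z : Type*} [TopologicalSpace T] [TopologicalSpace Z] (f : C(T, Z)) (x : T) :
    Pi1 T x →* Pi1 Z (f x) :=
  MonoidHom.op (FundamentalGroup.map f x)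

/-- The ordered configurations of `n` distinct points of `ℂ`, as a subspace of `ℂⁿ`. -/
abbrev OrdConf (n : ℕ) : Type := {f : Fin n → ℂ // Function.Injective f}

/-- The unordered configurations of `n` points: the subsets of `ℂ` with exactly `n` elements. -/
def Conf (n : ℕ) : Type := {s : Set ℂ // s.encard = n}

/-- The set of points of an ordered configuration. -/
def OrdConf.toConf {n : ℕ} (f : OrdConf n) : Conf n :=
  ⟨range f.1, by rw [← image_univ, f.2.encard_image]; simp⟩

/-- `Conf n` carries the quotient topology from the space of ordered configurations. -/
instance (n : ℕ) : TopologicalSpace (Conf n) :=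
  TopologicalSpace.coinduced OrdConf.toConf inferInstance

theorem continuous_toConf (n : ℕ) : Continuous (OrdConf.toConf (n := n)) :=
  continuous_coinduced_rng

/-- The braid group `B_n` on the strings that begin and end at the points of the
configuration `s`. -/
abbrev BraidGroup {n : ℕ} (s : Conf n) : Type := Pi1 (Conf n) s

/-! ### Artin generators -/

/-- The real part of `z` after a clockwise rotation of the plane by the angle `θ`. -/
def proj (θ : ℝ) (z : ℂ) : ℝ := (Complex.exp (-(θ * Complex.I)) * z).re

/-- The points of `s` have distinct real parts after a clockwise rotation by `θ`. -/
def IsGenericAngle {n : ℕ} (θ : ℝ) (s : Conf n) : Prop := InjOn (proj θ) s.1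

theorem exists_enum {n : ℕ} {θ : ℝ} {s : Conf n} (h : IsGenericAngle θ s) :
    ∃ p : Fin n → ℂ, range p = s.1 ∧ StrictMono fun j => proj θ (p j) := by
  have hfin : s.1.Finite := by
    apply Set.finite_of_encard_eq_coe s.2
  have hT : (hfin.toFinset.image (proj θ)).card = n := by
    rw [Finset.card_image_of_injOn (by rw [hfin.coe_toFinset]; exact h)]
    have := s.2
    rw [hfin.encard_eq_coe_toFinset_card] at this
    exact_mod_cast this
  set e := (hfin.toFinset.image (proj θ)).orderEmbOfFin hT with he
  have hmem : ∀ j, ∃ z ∈ s.1, proj θ z = e j := by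
    intro j
    obtain ⟨z, hz, hze⟩ :=
      Finset.mem_image.1 (Finset.orderEmbOfFin_mem (hfin.toFinset.image (proj θ)) hT j)
    exact ⟨z, hfin.mem_toFinset.1 hz, hze⟩
  choose p hp hpe using hmem
  refine ⟨p, ?_, ?_⟩
  · apply Subset.antisymm
    · rintro _ ⟨j, rfl⟩; exact hp j
    · intro z hz
      have : proj θ z ∈ range e := by
        rw [he, Finset.range_orderEmbOfFin]
        simpa using ⟨z, hz, rfl⟩
      obtain ⟨j, hj⟩ := this
      exact ⟨j, h (hp j) hz (by rw [hpe, hj])⟩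
  · intro a b hab
    simpa [hpe] using hab

/-- The points of `s`, enumerated from left to right after a clockwise rotation by `θ`. -/
def enum {n : ℕ} {θ : ℝ} {s : Conf n} (h : IsGenericAngle θ s) : Fin n → ℂ :=
  (exists_enum h).choose

theorem range_enum {n : ℕ} {θ : ℝ} {s : Conf n} (h : IsGenericAngle θ s) :
    range (enum h) = s.1 := (exists_enum h).choose_spec.1

theorem strictMono_enum {n : ℕ} {θ : ℝ} {s : Conf n} (h : IsGenericAngle θ s) :
    StrictMono fun j => proj θ (enum h j) := (exists_enum h).choose_spec.2

/-- The positive half-twist of two neighbouring points `p i` and `p (i + 1)`. With `m` their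
midpoint and `d = (p (i + 1) - p i) / 2`, they are at `m - w` and `m + w` at time `t`, where
`w = cos (π t) d + sin (π t) i e^{iθ}`; so they exchange their places counterclockwise, within the
strip that they bound when the plane is viewed in the direction `i e^{iθ}`. All other points
stay fixed. -/
def halfTwistFun {n : ℕ} (θ : ℝ) (p : Fin (n + 1) → ℂ) (i : Fin n) (t : ℝ) (j : Fin (n + 1)) : ℂ :=
  let m : ℂ := (p i.castSucc + p i.succ) / 2
  let d : ℂ := (p i.succ - p i.castSucc) / 2
  let w : ℂ := Real.cos (Real.pi * t) * d
    + Real.sin (Real.pi * t) * (Complex.I * Complex.exp (θ * Complex.I))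
  if j = i.castSucc then m - w else if j = i.succ then m + w else p j

theorem proj_add (θ : ℝ) (a b : ℂ) : proj θ (a + b) = proj θ a + proj θ b := by
  simp [proj, mul_add]

theorem proj_sub (θ : ℝ) (a b : ℂ) : proj θ (a - b) = proj θ a - proj θ b := by
  simp [proj, mul_sub]

theorem proj_real_mul (θ c : ℝ) (a : ℂ) : proj θ (c * a) = c * proj θ a := by
  rw [proj, mul_left_comm, Complex.re_ofReal_mul, proj]

theorem proj_half (θ : ℝ) (a : ℂ) : proj θ (a / 2) = proj θ a / 2 := by
  have : a / 2 = ((1 / 2 : ℝ) : ℂ) * a := by push_cast; ring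
  rw [this, proj_real_mul]; ring

theorem proj_normal (θ : ℝ) : proj θ (Complex.I * Complex.exp (θ * Complex.I)) = 0 := by
  rw [proj, mul_left_comm, ← Complex.exp_add]; simp

theorem halfTwistFun_injective {n : ℕ} {θ : ℝ} {p : Fin (n + 1) → ℂ}
    (hp : StrictMono fun j => proj θ (p j)) (i : Fin n) (t : ℝ) :
    Function.Injective (halfTwistFun θ p i t) := by
  set a := proj θ (p i.castSucc) with ha
  set b := proj θ (p i.succ) with hb
  have hab : a < b := hp (Fin.castSucc_lt_succ (i := i))
  set c := Real.cos (Real.pi * t) with hc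
  have hc1 : c ≤ 1 := Real.cos_le_one _
  have hc2 : -1 ≤ c := Real.neg_one_le_cos _
  have hne : i.succ ≠ i.castSucc := (Fin.castSucc_lt_succ (i := i)).ne'
  have hL : proj θ (halfTwistFun θ p i t i.castSucc) = (a + b) / 2 - c * ((b - a) / 2) := by
    simp only [halfTwistFun, if_true, proj_add, proj_sub, proj_half, proj_real_mul, proj_normal]
    ring
  have hR : proj θ (halfTwistFun θ p i t i.succ) = (a + b) / 2 + c * ((b - a) / 2) := by
    simp only [halfTwistFun, if_true, if_neg hne, proj_add, proj_sub, proj_half, proj_real_mul,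
      proj_normal]
    ring
  have hO : ∀ j, j ≠ i.castSucc → j ≠ i.succ →
      halfTwistFun θ p i t j = p j ∧ (proj θ (p j) < a ∨ b < proj θ (p j)) := by
    intro j h1 h2
    refine ⟨by simp [halfTwistFun, h1, h2], ?_⟩
    rcases lt_or_gt_of_ne h1 with h | h
    · exact Or.inl (hp h)
    · refine Or.inr (hp (lt_of_le_of_ne ?_ (Ne.symm h2)))
      simp only [Fin.lt_def, Fin.le_def, Fin.val_castSucc, Fin.val_succ] at h ⊢
      omega
  have hLR : halfTwistFun θ p i t i.castSucc ≠ halfTwistFun θ p i t i.succ := by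
    intro h
    have h' := congrArg (proj θ) h
    rw [hL, hR] at h'
    have hc0 : c = 0 := by
      have : c * (b - a) = 0 := by linarith
      exact (mul_eq_zero.1 this).resolve_right (by linarith)
    simp only [halfTwistFun, if_true, if_neg hne] at h
    rw [← hc, hc0] at h
    have hs : ((Real.sin (Real.pi * t) : ℝ) : ℂ) *
        (Complex.I * Complex.exp (θ * Complex.I)) = 0 := by
      push_cast at h ⊢
      linear_combination (-1 / 2 : ℂ) * h
    have hs0 : Real.sin (Real.pi * t) = 0 := by
      have hI : Complex.I * Complex.exp (θ * Complex.I) ≠ 0 :=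
        mul_ne_zero Complex.I_ne_zero (Complex.exp_ne_zero _)
      exact_mod_cast (mul_eq_zero.1 hs).resolve_right hI
    have := Real.sin_sq_add_cos_sq (Real.pi * t)
    rw [hs0, ← hc, hc0] at this
    norm_num at this
  have hLb : a ≤ (a + b) / 2 - c * ((b - a) / 2) ∧ (a + b) / 2 - c * ((b - a) / 2) ≤ b := by
    constructor <;> nlinarith
  have hRb : a ≤ (a + b) / 2 + c * ((b - a) / 2) ∧ (a + b) / 2 + c * ((b - a) / 2) ≤ b := by
    constructor <;> nlinarith
  have key : ∀ j k, j ≠ k → k ≠ i.castSucc → k ≠ i.succ →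
      halfTwistFun θ p i t j ≠ halfTwistFun θ p i t k := by
    intro j k hjk h1 h2 h
    obtain ⟨hk, hk'⟩ := hO k h1 h2
    by_cases hj1 : j = i.castSucc
    · have := congrArg (proj θ) h
      rw [hj1, hL, hk] at this
      rcases hk' with h' | h' <;> linarith [hLb.1, hLb.2]
    by_cases hj2 : j = i.succ
    · have := congrArg (proj θ) h
      rw [hj2, hR, hk] at this
      rcases hk' with h' | h' <;> linarith [hRb.1, hRb.2]
    · rw [(hO j hj1 hj2).1, hk] at h
      exact hjk (hp.injective (congrArg (proj θ) h))
  intro j k h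
  by_contra hjk
  by_cases hk : k ≠ i.castSucc ∧ k ≠ i.succ
  · exact key j k hjk hk.1 hk.2 h
  by_cases hj : j ≠ i.castSucc ∧ j ≠ i.succ
  · exact key k j (Ne.symm hjk) hj.1 hj.2 h.symm
  have hk' : k = i.castSucc ∨ k = i.succ := by tauto
  have hj' : j = i.castSucc ∨ j = i.succ := by tauto
  rcases hj' with rfl | rfl <;> rcases hk' with rfl | rfl
  · exact hjk rfl
  · exact hLR h
  · exact hLR h.symm
  · exact hjk rfl

theorem continuous_halfTwistFun {n : ℕ} (θ : ℝ) (p : Fin (n + 1) → ℂ) (i : Fin n) :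
    Continuous fun t : ℝ => halfTwistFun θ p i t := by
  refine continuous_pi fun j => ?_
  unfold halfTwistFun
  by_cases h1 : j = i.castSucc
  · simp only [h1, if_true]; fun_prop
  by_cases h2 : j = i.succ
  · simp only [h2, if_true, if_neg (Fin.castSucc_lt_succ (i := i)).ne']; fun_prop
  · simp only [h1, h2, if_false]; fun_prop

theorem halfTwistFun_zero {n : ℕ} (θ : ℝ) (p : Fin (n + 1) → ℂ) (i : Fin n) :
    halfTwistFun θ p i 0 = p := by
  funext j
  by_cases h1 : j = i.castSucc
  · simp [halfTwistFun, h1]; ring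
  by_cases h2 : j = i.succ
  · simp [halfTwistFun, h2, (Fin.castSucc_lt_succ (i := i)).ne']; ring
  · simp [halfTwistFun, h1, h2]

theorem halfTwistFun_one {n : ℕ} (θ : ℝ) (p : Fin (n + 1) → ℂ) (i : Fin n) :
    halfTwistFun θ p i 1 = p ∘ Equiv.swap i.castSucc i.succ := by
  funext j
  by_cases h1 : j = i.castSucc
  · simp [halfTwistFun, h1]; ring
  by_cases h2 : j = i.succ
  · simp [halfTwistFun, h2, (Fin.castSucc_lt_succ (i := i)).ne']; ring
  · simp [halfTwistFun, h1, h2, Equiv.swap_apply_of_ne_of_ne]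

/-- The positive half-twist of the `i`-th and the next point of `s`, as a loop of
configurations. -/
def halfTwist {n : ℕ} {θ : ℝ} {s : Conf (n + 1)} (h : IsGenericAngle θ s) (i : Fin n) :
    Path s s where
  toFun t := OrdConf.toConf
    ⟨halfTwistFun θ (enum h) i t, halfTwistFun_injective (strictMono_enum h) i t⟩
  continuous_toFun := (continuous_toConf _).comp <|
    ((continuous_halfTwistFun θ (enum h) i).comp continuous_subtype_val).subtype_mk _
  source' := Subtype.ext <| by
    simp [OrdConf.toConf, halfTwistFun_zero, range_enum]
  target' := Subtype.ext <| by
    simp [OrdConf.toConf, halfTwistFun_one, range_enum]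

/-- The Artin generators of `B_(n+1)` with base configuration `s`, with respect to the order of
the points of `s` from left to right after a clockwise rotation by `θ`; the indices
`0, 1, …, n - 1` stand for `σ₁, σ₂, …, σ_n`. -/
def artinGenerator {n : ℕ} {θ : ℝ} {s : Conf (n + 1)} (h : IsGenericAngle θ s) (i : Fin n) :
    BraidGroup s :=
  loopClass (halfTwist h i)

/-! ### Braid monodromy of a plane curve -/

/-- `K(x)`: the second coordinates of the points above `x` of the curve `F(x, y) = 0`. Here
`F` is a polynomial in `y` whose coefficients are polynomials in `x`. -/
def fiber (F : ℂ[X][Y]) (x : ℂ) : Set ℂ := {y | F.evalEval x y = 0}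

/-- `N`: the points above which the curve has fewer points than the degree of the projection. -/
def branchSet (F : ℂ[X][Y]) : Set ℂ := {x | (fiber F x).encard < F.natDegree}

theorem evalEval_eq (F : ℂ[X][Y]) (x y : ℂ) :
    F.evalEval x y = (F.map (evalRingHom x)).eval y := by
  rw [map_evalRingHom_eval]

theorem fiber_eq_roots {F : ℂ[X][Y]} (hF : F.Monic) (x : ℂ) :
    fiber F x = ((F.map (evalRingHom x)).roots.toFinset : Set ℂ) := by
  ext y
  have : F.map (evalRingHom x) ≠ 0 := (hF.map _).ne_zero
  simp [fiber, evalEval_eq, this]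

theorem encard_fiber {F : ℂ[X][Y]} (hF : F.Monic) {x : ℂ} (hx : x ∉ branchSet F) :
    (fiber F x).encard = F.natDegree := by
  refine le_antisymm ?_ (not_lt.1 hx)
  rw [fiber_eq_roots hF, Set.encard_coe_eq_coe_finsetCard]
  have h1 := Multiset.toFinset_card_le (F.map (evalRingHom x)).roots
  have h2 := Polynomial.card_roots' (F.map (evalRingHom x))
  rw [hF.natDegree_map] at h2
  exact_mod_cast h1.trans h2

theorem exists_near_root {F : ℂ[X][Y]} (hF : F.Monic) {x y : ℂ} {δ : ℝ} (hδ : 0 < δ)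
    (h : ‖F.evalEval x y‖ < δ ^ F.natDegree) : ∃ z ∈ fiber F x, ‖y - z‖ < δ := by
  by_contra! hcon
  have hm : (F.map (evalRingHom x)).Monic := hF.map _
  have hs := IsAlgClosed.splits (F.map (evalRingHom x))
  have hev := hs.eval_eq_prod_roots_of_monic hm y
  rw [evalEval_eq, hev] at h
  have hcard : (F.map (evalRingHom x)).roots.card = F.natDegree := by
    rw [← hs.natDegree_eq_card_roots, hF.natDegree_map]
  rw [← hcard] at h
  have hall : ∀ z ∈ (F.map (evalRingHom x)).roots, δ ≤ ‖y - z‖ := by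
    intro z hz
    apply hcon
    rw [fiber_eq_roots hF]
    simpa using hz
  have key : ∀ S : Multiset ℂ, (∀ z ∈ S, δ ≤ ‖y - z‖) →
      δ ^ S.card ≤ ‖(S.map fun a => y - a).prod‖ := by
    intro S
    induction S using Multiset.induction_on with
    | empty => simp
    | cons a S ih =>
      intro hS
      have h1 := hS a (Multiset.mem_cons_self _ _)
      have h2 := ih fun z hz => hS z (Multiset.mem_cons_of_mem hz)
      rw [Multiset.card_cons, Multiset.map_cons, Multiset.prod_cons, norm_mul, pow_succ']
      exact mul_le_mul h1 h2 (by positivity) (norm_nonneg _)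
  exact absurd h (not_lt.2 (key _ hall))

theorem continuous_fiber {F : ℂ[X][Y]} (hF : F.Monic) {n : ℕ} (hn : F.natDegree = n)
    (E : Set ℂ) : Continuous fun x : ↥(E \ branchSet F) =>
      show Conf n from ⟨fiber F x, by rw [encard_fiber hF x.2.2, hn]⟩ := by
  subst hn
  rw [continuous_iff_continuousAt]
  intro x₀
  rw [ContinuousAt, Filter.tendsto_def]
  intro W hW
  obtain ⟨U, hUW, hU, hxU⟩ := mem_nhds_iff.1 hW
  have hV : IsOpen (OrdConf.toConf ⁻¹' U) := hU.preimage (continuous_toConf _)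
  have hfin : (fiber F x₀).Finite := Set.finite_of_encard_eq_coe (encard_fiber hF x₀.2.2)
  have hcard : hfin.toFinset.card = F.natDegree := by
    have := encard_fiber hF x₀.2.2
    rw [hfin.encard_eq_coe_toFinset_card] at this
    exact_mod_cast this
  let e := hfin.toFinset.equivFinOfCardEq hcard
  let f₀ : OrdConf F.natDegree :=
    ⟨fun j => (e.symm j : ℂ), fun a b hab => e.symm.injective (Subtype.ext hab)⟩
  have hf₀ : range f₀.1 = fiber F x₀ := by
    ext y
    constructor
    · rintro ⟨j, rfl⟩
      exact hfin.mem_toFinset.1 (e.symm j).2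
    · intro hy
      exact ⟨e ⟨y, by simpa using hy⟩, by simp [f₀]⟩
  have hf₀U : f₀ ∈ OrdConf.toConf ⁻¹' U := by
    have : OrdConf.toConf f₀ = ⟨fiber F x₀, encard_fiber hF x₀.2.2⟩ := Subtype.ext hf₀
    rw [mem_preimage, this]; exact hxU
  obtain ⟨δ, hδ, hball⟩ := Metric.isOpen_iff.1 hV f₀ hf₀U
  have hsep : ∃ η > 0, ∀ a b, a ≠ b → η ≤ ‖f₀.1 a - f₀.1 b‖ := by
    by_cases hne : ((Finset.univ : Finset (Fin F.natDegree × Fin F.natDegree)).filter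
        fun q => q.1 ≠ q.2).Nonempty
    · obtain ⟨q, hq, hmin⟩ := Finset.exists_min_image _
        (fun q : Fin F.natDegree × Fin F.natDegree => ‖f₀.1 q.1 - f₀.1 q.2‖) hne
      refine ⟨_, ?_, fun a b hab => hmin (a, b) (by simpa using hab)⟩
      rw [gt_iff_lt, norm_pos_iff, sub_ne_zero]
      exact fun h => (by simpa using hq : q.1 ≠ q.2) (f₀.2 h)
    · refine ⟨1, one_pos, fun a b hab => absurd ⟨(a, b), by simpa using hab⟩ hne⟩
  obtain ⟨η, hη, hsep⟩ := hsep
  set ε := min (δ / 2) (η / 2) with hε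
  have hεpos : 0 < ε := by positivity
  have hev : ∀ᶠ x : ↥(E \ branchSet F) in 𝓝 x₀,
      ∀ j, ‖F.evalEval (x : ℂ) (f₀.1 j)‖ < ε ^ F.natDegree := by
    rw [Filter.eventually_all]
    intro j
    have hc : Continuous fun x : ↥(E \ branchSet F) => ‖F.evalEval (x : ℂ) (f₀.1 j)‖ :=
      (((F.eval (C (f₀.1 j))).continuous).comp continuous_subtype_val).norm
    have h0 : ‖F.evalEval (x₀ : ℂ) (f₀.1 j)‖ < ε ^ F.natDegree := by
      have : f₀.1 j ∈ fiber F x₀ := hf₀ ▸ mem_range_self j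
      have h0 : F.evalEval (x₀ : ℂ) (f₀.1 j) = 0 := this
      rw [h0, norm_zero]; positivity
    exact hc.continuousAt.eventually (gt_mem_nhds h0)
  filter_upwards [hev] with x hx
  choose g hg hgd using fun j => exists_near_root hF hεpos (hx j)
  have hginj : Function.Injective g := by
    intro a b hab
    by_contra hne
    have h1 := hsep a b hne
    have h2 : ‖f₀.1 a - f₀.1 b‖ ≤ ‖f₀.1 a - g a‖ + ‖f₀.1 b - g b‖ := by
      rw [← hab]
      calc ‖f₀.1 a - f₀.1 b‖ = ‖(f₀.1 a - g a) - (f₀.1 b - g a)‖ := by congr 1; ring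
        _ ≤ _ := norm_sub_le _ _
    have := hgd a
    have := hgd b
    have : ε ≤ η / 2 := min_le_right _ _
    linarith
  have hrange : range g = fiber F x := by
    have hfx : (fiber F x).Finite := Set.finite_of_encard_eq_coe (encard_fiber hF x.2.2)
    refine (hfx.subset (range_subset_iff.2 hg)).eq_of_subset_of_encard_le (range_subset_iff.2 hg) ?_
    rw [encard_fiber hF x.2.2, ← image_univ, hginj.encard_image]
    simp
  have hmem : (⟨g, hginj⟩ : OrdConf F.natDegree) ∈ OrdConf.toConf ⁻¹' U := by
    apply hball
    rw [Metric.mem_ball, Subtype.dist_eq, dist_pi_lt_iff hδ]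
    intro j
    have : ε ≤ δ / 2 := min_le_left _ _
    rw [dist_comm, dist_eq_norm]
    linarith [hgd j]
  apply hUW
  have : OrdConf.toConf ⟨g, hginj⟩ =
      (⟨fiber F x, encard_fiber hF x.2.2⟩ : Conf F.natDegree) := Subtype.ext hrange
  rw [mem_preimage, this] at hmem
  exact hmem

/-- The continuous map `x ↦ K(x)` from `E \ N` to the space of configurations of `n` points. -/
def fiberMap {F : ℂ[X][Y]} (hF : F.Monic) {n : ℕ} (hn : F.natDegree = n) (E : Set ℂ) :
    C(↥(E \ branchSet F), Conf n) :=
  ⟨fun x => ⟨fiber F x, by rw [encard_fiber hF x.2.2, hn]⟩, continuous_fiber hF hn E⟩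

/-- The braid monodromy over `E` of the curve `F(x, y) = 0`, for `F` monic in `y` of degree `n`:
the homomorphism `π₁(E \ N, M) → B_n` that sends the class of a loop `γ` to the braid whose
strings are the `n` lifts of `γ` to the curve, projected to the second coordinate. -/
def braidMonodromy {F : ℂ[X][Y]} (hF : F.Monic) {n : ℕ} (hn : F.natDegree = n) (E : Set ℂ)
    (M : ↥(E \ branchSet F)) :
    Pi1 ↥(E \ branchSet F) M →* BraidGroup (fiberMap hF hn E M) :=
  Pi1.map (fiberMap hF hn E) M

/-! ### The curve -/

/-- The polynomial `y (y³ - x²)`. -/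
def cuspLine : ℂ[X][Y] := Y * (Y ^ 3 - C (X ^ 2))

theorem cuspLine_monic : cuspLine.Monic :=
  monic_X.mul (monic_X_pow_sub_C _ three_ne_zero)

theorem cuspLine_natDegree : cuspLine.natDegree = 4 := by
  rw [cuspLine, monic_X.natDegree_mul (monic_X_pow_sub_C _ three_ne_zero), natDegree_X,
    natDegree_X_pow_sub_C]

end BraidMonodromy

end

open BraidMonodromy

open BraidMonodromy
namespace BraidMonodromy

/-! ### Loops and homotopies -/

/-! Above `x = r e^{ia}` lie the centre `0` and the vertices of an equilateral triangle on the
circle of radius `R`, where `R ^ 3 = r ^ 2`, rotated by `2a/3`. One turn of `x` rotates the triangle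
by `4π/3`, that is, twice by `2π/3`. Rotation by `2π/3` permutes the vertices, so it is already a
loop of configurations, and the monodromy of the circle is its square (`map_fiberMap_eq_trans`).

It remains to read off one such rotation as a braid (`loopClass_cuspRotation`). Seen after a
clockwise rotation by `θ`, the leftmost vertex passes below the other three points, one after
another, at the angles `θ`, `θ + π/6` and `θ + π/3`; at `θ + π/2` the centre passes below the vertex
that started on the right. These crossings give `σ₁σ₂σ₃σ₂`. The comparison with half-twists is a
straight-line homotopy of labelled configurations: no two points collide if, for each pair and each
time, one real linear form orders the pair in the same way at both ends of the segment
(`segment_subset_injective`). Away from the crossing time the real part after rotation is such a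
form, up to sign; at the crossing it is the imaginary part, which records that the crossing is
positive.

For the image, logarithms of loops show that the boundary circle generates the fundamental group of
the punctured disk (`zpowers_loopClass_eq_top`). -/

theorem loopClass_eq {T : Type*} [TopologicalSpace T] {x : T} {γ δ : Path x x}
    (h : γ.Homotopic δ) : loopClass γ = loopClass δ := by
  rw [loopClass, loopClass, Path.Homotopic.Quotient.eq.2 h]

theorem loopClass_trans {T : Type*} [TopologicalSpace T] {x : T} (γ δ : Path x x) :
    loopClass (γ.trans δ) = loopClass γ * loopClass δ := rfl

theorem loopClass_symm {T : Type*} [TopologicalSpace T] {x : T} (γ : Path x x) :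
    loopClass γ.symm = (loopClass γ)⁻¹ := rfl

theorem loopClass_refl {T : Type*} [TopologicalSpace T] (x : T) :
    loopClass (Path.refl x) = 1 := rfl

theorem exists_loopClass_eq {T : Type*} [TopologicalSpace T] {x : T} (g : Pi1 T x) :
    ∃ γ : Path x x, loopClass γ = g := by
  obtain ⟨γ, hγ⟩ := Path.Homotopic.Quotient.mk_surjective (MulOpposite.unop g)
  exact ⟨γ, by rw [loopClass, hγ]; rfl⟩

theorem Pi1.map_loopClass {T Z : Type*} [TopologicalSpace T] [TopologicalSpace Z] (f : C(T, Z))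
    {x : T} (γ : Path x x) : Pi1.map f x (loopClass γ) = loopClass (γ.map f.continuous) := rfl

/-- A pointwise relation between two pairs of composable paths passes to the concatenations. -/
theorem forall_trans_apply {A B : Type*} [TopologicalSpace A] [TopologicalSpace B]
    {P : A → B → Prop} {a₀ a₁ a₂ : A} {b₀ b₁ b₂ : B} {α : Path a₀ a₁} {α' : Path a₁ a₂}
    {β : Path b₀ b₁} {β' : Path b₁ b₂} (h : ∀ t, P (α t) (β t)) (h' : ∀ t, P (α' t) (β' t))
    (t : unitInterval) : P (α.trans α' t) (β.trans β' t) := by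
  rw [Path.trans_apply, Path.trans_apply]
  split_ifs
  · exact h _
  · exact h' _

/-- Two paths that are the images of paths in a subset of a vector space are homotopic if the
segments between corresponding points lie in the subset. -/
theorem homotopic_of_segment_subset {V T : Type*} [AddCommGroup V] [Module ℝ V]
    [TopologicalSpace V] [IsTopologicalAddGroup V] [ContinuousSMul ℝ V] [TopologicalSpace T]
    {U : Set V} (f : C(U, T)) {x y : T} {γ δ : Path x y} {u v : unitInterval → V}
    (hu : Continuous u) (hv : Continuous v) (h : ∀ t, segment ℝ (u t) (v t) ⊆ U)
    (h0 : u 0 = v 0) (h1 : u 1 = v 1)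
    (hγ : ∀ t, γ t = f ⟨u t, h t (left_mem_segment ℝ _ _)⟩)
    (hδ : ∀ t, δ t = f ⟨v t, h t (right_mem_segment ℝ _ _)⟩) : γ.Homotopic δ := by
  have hmem : ∀ q : unitInterval × unitInterval,
      AffineMap.lineMap (u q.2) (v q.2) (q.1 : ℝ) ∈ U := fun q =>
    h q.2 (segment_eq_image_lineMap ℝ (u q.2) (v q.2) ▸ mem_image_of_mem _ q.1.2)
  have hf : ∀ {a b : V} (ha : a ∈ U) (hb : b ∈ U), a = b → f ⟨a, ha⟩ = f ⟨b, hb⟩ := by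
    rintro a _ _ _ rfl; rfl
  exact ⟨{
    toFun := fun q => f ⟨AffineMap.lineMap (u q.2) (v q.2) (q.1 : ℝ), hmem q⟩
    continuous_toFun := by
      refine f.continuous.comp (Continuous.subtype_mk ?_ _)
      simp only [AffineMap.lineMap_apply_module]
      fun_prop
    map_zero_left := fun t => by
      refine (hf _ (h t (left_mem_segment ℝ _ _)) ?_).trans (hγ t).symm
      simp
    map_one_left := fun t => by
      refine (hf _ (h t (right_mem_segment ℝ _ _)) ?_).trans (hδ t).symm
      simp
    prop' := by
      rintro s t (rfl | rfl)
      · refine (hf _ (h _ (left_mem_segment ℝ _ _)) ?_).trans (hγ _).symm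
        simp [← h0]
      · refine (hf _ (h _ (left_mem_segment ℝ _ _)) ?_).trans (hγ _).symm
        simp [← h1] }⟩

/-! ### Linear homotopies of configurations -/

/-- The real part after a clockwise rotation by `θ`, as a linear form. -/
noncomputable def projForm (θ : ℝ) : ℂ →ₗ[ℝ] ℝ :=
  Complex.reLm ∘ₗ LinearMap.mulLeft ℝ (Complex.exp (-(θ * Complex.I)))

/-- The imaginary part after a clockwise rotation by `θ`, as a linear form. -/
noncomputable def heightForm (θ : ℝ) : ℂ →ₗ[ℝ] ℝ :=
  Complex.imLm ∘ₗ LinearMap.mulLeft ℝ (Complex.exp (-(θ * Complex.I)))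

theorem projForm_apply (θ : ℝ) (z : ℂ) : projForm θ z = proj θ z := rfl

theorem heightForm_apply (θ : ℝ) (z : ℂ) :
    heightForm θ z = (Complex.exp (-(θ * Complex.I)) * z).im := rfl

theorem heightForm_normal (θ : ℝ) :
    heightForm θ (Complex.I * Complex.exp (θ * Complex.I)) = 1 := by
  rw [heightForm_apply, mul_left_comm, ← Complex.exp_add]; simp

/-- A linear form with `L (f a) < L (f b)` and `L (g a) < L (g b)` keeps this strict order on every
convex combination, so points `a` and `b` never meet. The form may depend on the pair. -/
theorem segment_subset_injective {n : ℕ} {f g : Fin n → ℂ}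
    (h : ∀ a b, a < b → ∃ L : ℂ →ₗ[ℝ] ℝ, L (f a) < L (f b) ∧ L (g a) < L (g b)) :
    segment ℝ f g ⊆ {p | Function.Injective p} := by
  rintro _ ⟨s, t, hs, ht, hst, rfl⟩
  have key : ∀ a b, a < b → (s • f + t • g) a ≠ (s • f + t • g) b := by
    intro a b hab heq
    obtain ⟨L, h1, h2⟩ := h a b hab
    have h3 := congrArg L heq
    simp only [Pi.add_apply, Pi.smul_apply, map_add, map_smul, smul_eq_mul] at h3
    -- At least one weight is positive: for `s = 0` strictness comes from `g`, otherwise from `f`.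
    rcases hs.eq_or_lt with rfl | hs
    · have : t = 1 := by linarith
      subst this
      linarith
    · nlinarith [mul_lt_mul_of_pos_left h1 hs, mul_le_mul_of_nonneg_left h2.le ht]
  intro a b hab
  by_contra hne
  rcases lt_or_gt_of_ne hne with hlt | hlt
  · exact key a b hlt hab
  · exact key b a hlt hab.symm

theorem segment_comp_subset_injective {n : ℕ} {f g : Fin n → ℂ} {π : Fin n → Fin n}
    (hπ : Function.Injective π) (h : segment ℝ f g ⊆ {p | Function.Injective p}) :
    segment ℝ (f ∘ π) (g ∘ π) ⊆ {p | Function.Injective p} := by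
  rintro _ ⟨s, t, hs, ht, hst, rfl⟩
  exact (h ⟨s, t, hs, ht, hst, rfl⟩ : Function.Injective _).comp hπ

/-! ### Order of the points during a half-twist -/

theorem proj_halfTwistFun_castSucc {n : ℕ} (θ : ℝ) (p : Fin (n + 1) → ℂ) (i : Fin n) (t : ℝ) :
    proj θ (halfTwistFun θ p i t i.castSucc) =
      (proj θ (p i.castSucc) + proj θ (p i.succ)) / 2
        - Real.cos (Real.pi * t) * ((proj θ (p i.succ) - proj θ (p i.castSucc)) / 2) := by
  simp only [halfTwistFun, if_true, proj_add, proj_sub, proj_half, proj_real_mul, proj_normal]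
  ring

theorem proj_halfTwistFun_succ {n : ℕ} (θ : ℝ) (p : Fin (n + 1) → ℂ) (i : Fin n) (t : ℝ) :
    proj θ (halfTwistFun θ p i t i.succ) =
      (proj θ (p i.castSucc) + proj θ (p i.succ)) / 2
        + Real.cos (Real.pi * t) * ((proj θ (p i.succ) - proj θ (p i.castSucc)) / 2) := by
  simp only [halfTwistFun, if_true, if_neg (Fin.castSucc_lt_succ (i := i)).ne', proj_add,
    proj_sub, proj_half, proj_real_mul, proj_normal]
  ring

theorem halfTwistFun_of_ne {n : ℕ} (θ : ℝ) (p : Fin (n + 1) → ℂ) (i : Fin n) (t : ℝ)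
    {j : Fin (n + 1)} (h1 : j ≠ i.castSucc) (h2 : j ≠ i.succ) : halfTwistFun θ p i t j = p j := by
  simp [halfTwistFun, h1, h2]

/-- At half time `w` is the unit normal `i e^{iθ}`, so the points are vertically aligned at distance
2. This is the only time in the unit interval at which the projection fails to separate them. -/
theorem heightForm_halfTwistFun_half {n : ℕ} (θ : ℝ) (p : Fin (n + 1) → ℂ) (i : Fin n) :
    heightForm θ (halfTwistFun θ p i (1 / 2) i.castSucc) <
      heightForm θ (halfTwistFun θ p i (1 / 2) i.succ) := by
  have hc : Real.cos (Real.pi * (1 / 2)) = 0 := by rw [mul_one_div, Real.cos_pi_div_two]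
  have hs : Real.sin (Real.pi * (1 / 2)) = 1 := by rw [mul_one_div, Real.sin_pi_div_two]
  simp only [halfTwistFun, if_true, if_neg (Fin.castSucc_lt_succ (i := i)).ne', hc, hs, map_add,
    map_sub, Complex.ofReal_zero, zero_mul, zero_add, Complex.ofReal_one, one_mul,
    heightForm_normal]
  linarith

/-- The two moving points stay in the closed strip between their initial projections, and all fixed
points project strictly outside it. Hence only the moving pair can change order. -/
theorem proj_halfTwistFun_lt {n : ℕ} {θ : ℝ} {p : Fin (n + 1) → ℂ}
    (hp : StrictMono fun j => proj θ (p j)) (i : Fin n) (t : ℝ) {a b : Fin (n + 1)} (hab : a < b)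
    (hne : ¬(a = i.castSucc ∧ b = i.succ)) :
    proj θ (halfTwistFun θ p i t a) < proj θ (halfTwistFun θ p i t b) := by
  have h01 : proj θ (p i.castSucc) < proj θ (p i.succ) := hp (Fin.castSucc_lt_succ (i := i))
  have hc1 := Real.cos_le_one (Real.pi * t)
  have hc2 := Real.neg_one_le_cos (Real.pi * t)
  have hL := proj_halfTwistFun_castSucc θ p i t
  have hR := proj_halfTwistFun_succ θ p i t
  have hcs : i.castSucc < i.succ := Fin.castSucc_lt_succ
  by_cases ha1 : a = i.castSucc
  · subst ha1
    have hb2 : b ≠ i.succ := fun h => hne ⟨rfl, h⟩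
    have hb : proj θ (p i.succ) < proj θ (p b) := by
      refine hp (lt_of_le_of_ne ?_ (Ne.symm hb2))
      simp only [Fin.lt_def, Fin.le_def, Fin.val_castSucc, Fin.val_succ] at hab ⊢
      omega
    rw [halfTwistFun_of_ne θ p i t hab.ne' hb2, hL]
    nlinarith
  by_cases ha2 : a = i.succ
  · subst ha2
    have hb : proj θ (p i.succ) < proj θ (p b) := hp hab
    rw [halfTwistFun_of_ne θ p i t (hcs.trans hab).ne' hab.ne', hR]
    nlinarith
  rw [halfTwistFun_of_ne θ p i t ha1 ha2]
  by_cases hb1 : b = i.castSucc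
  · subst hb1
    have ha : proj θ (p a) < proj θ (p i.castSucc) := hp hab
    rw [hL]
    nlinarith
  by_cases hb2 : b = i.succ
  · subst hb2
    have ha : proj θ (p a) < proj θ (p i.castSucc) := by
      refine hp (lt_of_le_of_ne ?_ ha1)
      simp only [Fin.lt_def, Fin.le_def, Fin.val_castSucc, Fin.val_succ] at hab ⊢
      omega
    rw [hR]
    nlinarith
  rw [halfTwistFun_of_ne θ p i t hb1 hb2]
  exact hp hab

/-- A half-twist can be joined linearly, at a time `t`, with every configuration whose points are
in the same order from left to right, and whose two crossing points exchange their order at the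
time `1 / 2`, the left one passing below the right one. -/
theorem segment_halfTwistFun_subset_injective {n : ℕ} {θ : ℝ} {p q : Fin (n + 1) → ℂ}
    (hp : StrictMono fun j => proj θ (p j)) {i : Fin n} {t : ℝ} (ht : t ∈ Icc (0 : ℝ) 1)
    (hq : ∀ a b, a < b → ¬(a = i.castSucc ∧ b = i.succ) → proj θ (q a) < proj θ (q b))
    (hlt : t < 1 / 2 → proj θ (q i.castSucc) < proj θ (q i.succ))
    (heq : t = 1 / 2 → heightForm θ (q i.castSucc) < heightForm θ (q i.succ))
    (hgt : 1 / 2 < t → proj θ (q i.succ) < proj θ (q i.castSucc)) :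
    segment ℝ (halfTwistFun θ p i t) q ⊆ {f | Function.Injective f} := by
  apply segment_subset_injective
  intro a b hab
  by_cases hne : a = i.castSucc ∧ b = i.succ
  · obtain ⟨rfl, rfl⟩ := hne
    have h01 : proj θ (p i.castSucc) < proj θ (p i.succ) := hp hab
    have hL := proj_halfTwistFun_castSucc θ p i t
    have hR := proj_halfTwistFun_succ θ p i t
    have hpi := Real.pi_pos
    -- The sign of `cos (π t)` decides the separating form: the projection before half time, the
    -- height at half time, minus the projection afterwards.
    rcases lt_trichotomy t (1 / 2) with h | h | h
    · have hc : 0 < Real.cos (Real.pi * t) :=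
        Real.cos_pos_of_mem_Ioo ⟨by nlinarith [ht.1], by nlinarith⟩
      refine ⟨projForm θ, ?_, hlt h⟩
      rw [projForm_apply, projForm_apply, hL, hR]
      nlinarith
    · exact ⟨heightForm θ, h ▸ heightForm_halfTwistFun_half θ p i, heq h⟩
    · have hc : Real.cos (Real.pi * t) < 0 :=
        Real.cos_neg_of_pi_div_two_lt_of_lt (by nlinarith) (by nlinarith [ht.2])
      refine ⟨-projForm θ, ?_, by simpa [projForm_apply] using hgt h⟩
      rw [LinearMap.neg_apply, LinearMap.neg_apply, projForm_apply, projForm_apply, hL, hR]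
      nlinarith
  · exact ⟨projForm θ, proj_halfTwistFun_lt hp i t hab hne, hq a b hab hne⟩

/-- The strands of a half-twist, the strand labelled `j` beginning at the point number `π j`. -/
noncomputable def strandPath {n : ℕ} (θ : ℝ) (p : Fin (n + 1) → ℂ) (i : Fin n)
    (π π' : Fin (n + 1) → Fin (n + 1)) (h : ∀ j, Equiv.swap i.castSucc i.succ (π j) = π' j) :
    Path (p ∘ π) (p ∘ π') where
  toFun t := halfTwistFun θ p i t ∘ π
  continuous_toFun := by
    have := (continuous_halfTwistFun θ p i).comp
      (continuous_subtype_val (p := fun t => t ∈ unitInterval))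
    exact continuous_pi fun j => (continuous_apply (π j)).comp this
  source' := by simp [halfTwistFun_zero]
  target' := by
    funext j
    simp [halfTwistFun_one, h]

/-- Labels are needed because the homotopies live in the space of ordered tuples, where each strand
must keep its label through successive half-twists; the underlying set does not see them. -/
theorem range_strandPath {n : ℕ} {θ : ℝ} {s : Conf (n + 1)} (hs : IsGenericAngle θ s) (i : Fin n)
    (π π' : Fin (n + 1) → Fin (n + 1)) (h : ∀ j, Equiv.swap i.castSucc i.succ (π j) = π' j)
    (hπ : Function.Injective π) (t : unitInterval) :
    (halfTwist hs i t).1 = range (strandPath θ (enum hs) i π π' h t) := by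
  have : range (halfTwistFun θ (enum hs) i t ∘ π) = range (halfTwistFun θ (enum hs) i t) :=
    (Finite.surjective_of_injective hπ).range_comp _
  exact this.symm

/-! ### The points of the curve above a circle -/

/-- The point `R e^{ia}`. -/
noncomputable def polarPoint (R a : ℝ) : ℂ := R * Complex.exp (a * Complex.I)

theorem proj_polarPoint (θ R a : ℝ) : proj θ (polarPoint R a) = R * Real.cos (a - θ) := by
  rw [proj, polarPoint, mul_left_comm, ← Complex.exp_add, Complex.re_ofReal_mul,
    ← Complex.exp_ofReal_mul_I_re]
  push_cast
  ring_nf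

theorem heightForm_polarPoint (θ R a : ℝ) :
    heightForm θ (polarPoint R a) = R * Real.sin (a - θ) := by
  rw [heightForm_apply, polarPoint, mul_left_comm, ← Complex.exp_add, Complex.im_ofReal_mul,
    ← Complex.exp_ofReal_mul_I_im]
  push_cast
  ring_nf

theorem polarPoint_add_two_pi (R a : ℝ) : polarPoint R (a + 2 * Real.pi) = polarPoint R a := by
  rw [polarPoint, polarPoint]
  push_cast
  rw [add_mul, Complex.exp_periodic]

theorem continuous_polarPoint (R : ℝ) : Continuous (polarPoint R) := by
  unfold polarPoint
  fun_prop

/-- The centre and the vertices of an equilateral triangle in a circle of radius `R`, rotated by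
`φ`; for small negative `φ` they are listed from left to right. -/
noncomputable def cuspPoints (R φ : ℝ) : Fin 4 → ℂ :=
  ![polarPoint R (φ + 4 * Real.pi / 3), polarPoint R (φ + 2 * Real.pi / 3), 0, polarPoint R φ]

theorem continuous_cuspPoints (R : ℝ) : Continuous (cuspPoints R) := by
  refine continuous_pi fun j => ?_
  fin_cases j
  · exact (continuous_polarPoint R).comp (by fun_prop)
  · exact (continuous_polarPoint R).comp (by fun_prop)
  · exact continuous_const
  · exact continuous_polarPoint R

theorem cuspPoints_add (R φ : ℝ) :
    cuspPoints R (φ + 2 * Real.pi / 3) = cuspPoints R φ ∘ ![3, 0, 2, 1] := by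
  funext j
  fin_cases j
  · show polarPoint R _ = polarPoint R _
    rw [← polarPoint_add_two_pi R φ]; congr 1; ring
  · show polarPoint R _ = polarPoint R _
    congr 1; ring
  · rfl
  · rfl

theorem range_cuspPoints_add (R φ : ℝ) :
    range (cuspPoints R (φ + 2 * Real.pi / 3)) = range (cuspPoints R φ) := by
  rw [cuspPoints_add, Function.Surjective.range_comp]
  decide

/-! ### Crossings of the rotating points -/

section Order

variable {R φ θ : ℝ}

/-- This and the next five formulas write each difference of projections as a positive multiple (for
`R > 0`) of a sine whose phase vanishes when the two points are aligned. The order of a pair is then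
the sign of a sine. -/
theorem proj_cuspPoints_zero_sub_one : proj θ (cuspPoints R φ 0) - proj θ (cuspPoints R φ 1) =
    2 * R * Real.sin (Real.pi / 3) * Real.sin (φ - θ) := by
  show proj θ (polarPoint R _) - proj θ (polarPoint R _) = _
  rw [proj_polarPoint, proj_polarPoint, ← mul_sub, Real.cos_sub_cos,
    show (φ + 4 * Real.pi / 3 - θ + (φ + 2 * Real.pi / 3 - θ)) / 2 = φ - θ + Real.pi by ring,
    show (φ + 4 * Real.pi / 3 - θ - (φ + 2 * Real.pi / 3 - θ)) / 2 = Real.pi / 3 by ring,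
    Real.sin_add_pi]
  ring

theorem proj_cuspPoints_zero_sub_two : proj θ (cuspPoints R φ 0) - proj θ (cuspPoints R φ 2) =
    R * Real.sin (φ - θ - Real.pi / 6) := by
  show proj θ (polarPoint R _) - proj θ 0 = _
  rw [proj_polarPoint, show proj θ 0 = 0 by simp [proj], sub_zero,
    show φ + 4 * Real.pi / 3 - θ = φ - θ - Real.pi / 6 - Real.pi / 2 + 2 * Real.pi by ring,
    Real.cos_add_two_pi, Real.cos_sub_pi_div_two]

theorem proj_cuspPoints_zero_sub_three : proj θ (cuspPoints R φ 0) - proj θ (cuspPoints R φ 3) =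
    2 * R * Real.sin (Real.pi / 3) * Real.sin (φ - θ - Real.pi / 3) := by
  show proj θ (polarPoint R _) - proj θ (polarPoint R _) = _
  rw [proj_polarPoint, proj_polarPoint, ← mul_sub, Real.cos_sub_cos,
    show (φ + 4 * Real.pi / 3 - θ + (φ - θ)) / 2 = φ - θ - Real.pi / 3 + Real.pi by ring,
    show (φ + 4 * Real.pi / 3 - θ - (φ - θ)) / 2 = Real.pi - Real.pi / 3 by ring,
    Real.sin_add_pi, Real.sin_pi_sub]
  ring

theorem proj_cuspPoints_two_sub_one : proj θ (cuspPoints R φ 2) - proj θ (cuspPoints R φ 1) =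
    R * Real.sin (φ - θ + Real.pi / 6) := by
  show proj θ 0 - proj θ (polarPoint R _) = _
  rw [proj_polarPoint, show proj θ 0 = 0 by simp [proj], zero_sub,
    show φ + 2 * Real.pi / 3 - θ = φ - θ + Real.pi / 6 + Real.pi / 2 by ring,
    Real.cos_add_pi_div_two]
  ring

theorem proj_cuspPoints_three_sub_one : proj θ (cuspPoints R φ 3) - proj θ (cuspPoints R φ 1) =
    2 * R * Real.sin (Real.pi / 3) * Real.sin (φ - θ + Real.pi / 3) := by
  show proj θ (polarPoint R _) - proj θ (polarPoint R _) = _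
  rw [proj_polarPoint, proj_polarPoint, ← mul_sub, Real.cos_sub_cos,
    show (φ - θ + (φ + 2 * Real.pi / 3 - θ)) / 2 = φ - θ + Real.pi / 3 by ring,
    show (φ - θ - (φ + 2 * Real.pi / 3 - θ)) / 2 = -(Real.pi / 3) by ring,
    Real.sin_neg]
  ring

theorem proj_cuspPoints_two_sub_three : proj θ (cuspPoints R φ 2) - proj θ (cuspPoints R φ 3) =
    R * Real.sin (φ - θ - Real.pi / 2) := by
  show proj θ 0 - proj θ (polarPoint R _) = _
  rw [proj_polarPoint, show proj θ 0 = 0 by simp [proj], zero_sub, Real.sin_sub_pi_div_two]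
  ring

theorem sin_pi_div_three_pos : 0 < Real.sin (Real.pi / 3) :=
  Real.sin_pos_of_pos_of_lt_pi (by linarith [Real.pi_pos]) (by linarith [Real.pi_pos])

/-- During a rotation by `2 π / 3` the second point stays left of the centre and of the last
point. -/
theorem proj_cuspPoints_one_lt (hR : 0 < R) (h0 : -(Real.pi / 6) < φ - θ)
    (h1 : φ - θ < 2 * Real.pi / 3) :
    proj θ (cuspPoints R φ 1) < proj θ (cuspPoints R φ 2) ∧
      proj θ (cuspPoints R φ 1) < proj θ (cuspPoints R φ 3) := by
  have hs := sin_pi_div_three_pos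
  constructor <;> rw [← sub_pos]
  · rw [proj_cuspPoints_two_sub_one]
    have := Real.sin_pos_of_pos_of_lt_pi (x := φ - θ + Real.pi / 6) (by linarith) (by linarith)
    positivity
  · rw [proj_cuspPoints_three_sub_one]
    have := Real.sin_pos_of_pos_of_lt_pi (x := φ - θ + Real.pi / 3) (by linarith) (by linarith)
    positivity

theorem proj_cuspPoints_zero_lt_one (hR : 0 < R) (h0 : -Real.pi < φ - θ) (h1 : φ - θ < 0) :
    proj θ (cuspPoints R φ 0) < proj θ (cuspPoints R φ 1) := by
  rw [← sub_neg, proj_cuspPoints_zero_sub_one]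
  exact mul_neg_of_pos_of_neg (mul_pos (by positivity) sin_pi_div_three_pos)
    (Real.sin_neg_of_neg_of_neg_pi_lt h1 h0)

theorem proj_cuspPoints_one_lt_zero (hR : 0 < R) (h0 : 0 < φ - θ) (h1 : φ - θ < Real.pi) :
    proj θ (cuspPoints R φ 1) < proj θ (cuspPoints R φ 0) := by
  rw [← sub_pos, proj_cuspPoints_zero_sub_one]
  exact mul_pos (mul_pos (by positivity) sin_pi_div_three_pos)
    (Real.sin_pos_of_pos_of_lt_pi h0 h1)

theorem proj_cuspPoints_zero_lt_two (hR : 0 < R) (h0 : -Real.pi / 2 < φ - θ)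
    (h1 : φ - θ < Real.pi / 6) : proj θ (cuspPoints R φ 0) < proj θ (cuspPoints R φ 2) := by
  rw [← sub_neg, proj_cuspPoints_zero_sub_two]
  exact mul_neg_of_pos_of_neg hR
    (Real.sin_neg_of_neg_of_neg_pi_lt (by linarith) (by linarith [Real.pi_pos]))

theorem proj_cuspPoints_two_lt_zero (hR : 0 < R) (h0 : Real.pi / 6 < φ - θ)
    (h1 : φ - θ < Real.pi) : proj θ (cuspPoints R φ 2) < proj θ (cuspPoints R φ 0) := by
  rw [← sub_pos, proj_cuspPoints_zero_sub_two]
  exact mul_pos hR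
    (Real.sin_pos_of_pos_of_lt_pi (by linarith) (by linarith [Real.pi_pos]))

theorem proj_cuspPoints_zero_lt_three (hR : 0 < R) (h0 : -Real.pi / 2 < φ - θ)
    (h1 : φ - θ < Real.pi / 3) : proj θ (cuspPoints R φ 0) < proj θ (cuspPoints R φ 3) := by
  rw [← sub_neg, proj_cuspPoints_zero_sub_three]
  exact mul_neg_of_pos_of_neg (mul_pos (by positivity) sin_pi_div_three_pos)
    (Real.sin_neg_of_neg_of_neg_pi_lt (by linarith) (by linarith [Real.pi_pos]))

theorem proj_cuspPoints_three_lt_zero (hR : 0 < R) (h0 : Real.pi / 3 < φ - θ)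
    (h1 : φ - θ < Real.pi) : proj θ (cuspPoints R φ 3) < proj θ (cuspPoints R φ 0) := by
  rw [← sub_pos, proj_cuspPoints_zero_sub_three]
  exact mul_pos (mul_pos (by positivity) sin_pi_div_three_pos)
    (Real.sin_pos_of_pos_of_lt_pi (by linarith) (by linarith [Real.pi_pos]))

theorem proj_cuspPoints_two_lt_three (hR : 0 < R) (h0 : -Real.pi / 2 < φ - θ)
    (h1 : φ - θ < Real.pi / 2) : proj θ (cuspPoints R φ 2) < proj θ (cuspPoints R φ 3) := by
  rw [← sub_neg, proj_cuspPoints_two_sub_three]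
  exact mul_neg_of_pos_of_neg hR
    (Real.sin_neg_of_neg_of_neg_pi_lt (by linarith) (by linarith [Real.pi_pos]))

theorem proj_cuspPoints_three_lt_two (hR : 0 < R) (h0 : Real.pi / 2 < φ - θ)
    (h1 : φ - θ < Real.pi) : proj θ (cuspPoints R φ 3) < proj θ (cuspPoints R φ 2) := by
  rw [← sub_pos, proj_cuspPoints_two_sub_three]
  exact mul_pos hR
    (Real.sin_pos_of_pos_of_lt_pi (by linarith) (by linarith [Real.pi_pos]))

/-- At each of the four crossings the point coming from the left is the lower one, as in a positive
half-twist. -/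
theorem height_cuspPoints_zero_lt_one (hR : 0 < R) (h : φ - θ = 0) :
    heightForm θ (cuspPoints R φ 0) < heightForm θ (cuspPoints R φ 1) := by
  show heightForm θ (polarPoint R _) < heightForm θ (polarPoint R _)
  rw [heightForm_polarPoint, heightForm_polarPoint]
  refine mul_lt_mul_of_pos_left ?_ hR
  rw [show φ + 4 * Real.pi / 3 - θ = Real.pi / 3 + Real.pi by linarith,
    show φ + 2 * Real.pi / 3 - θ = Real.pi - Real.pi / 3 by linarith, Real.sin_add_pi,
    Real.sin_pi_sub]
  linarith [sin_pi_div_three_pos]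

theorem height_cuspPoints_zero_lt_two (hR : 0 < R) (h : φ - θ = Real.pi / 6) :
    heightForm θ (cuspPoints R φ 0) < heightForm θ (cuspPoints R φ 2) := by
  show heightForm θ (polarPoint R _) < heightForm θ 0
  rw [heightForm_polarPoint, map_zero,
    show φ + 4 * Real.pi / 3 - θ = Real.pi / 2 + Real.pi by linarith, Real.sin_add_pi,
    Real.sin_pi_div_two]
  linarith

theorem height_cuspPoints_zero_lt_three (hR : 0 < R) (h : φ - θ = Real.pi / 3) :
    heightForm θ (cuspPoints R φ 0) < heightForm θ (cuspPoints R φ 3) := by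
  show heightForm θ (polarPoint R _) < heightForm θ (polarPoint R _)
  rw [heightForm_polarPoint, heightForm_polarPoint]
  refine mul_lt_mul_of_pos_left ?_ hR
  rw [show φ + 4 * Real.pi / 3 - θ = -(Real.pi / 3) + 2 * Real.pi by linarith, h,
    Real.sin_add_two_pi, Real.sin_neg]
  linarith [sin_pi_div_three_pos]

theorem height_cuspPoints_two_lt_three (hR : 0 < R) (h : φ - θ = Real.pi / 2) :
    heightForm θ (cuspPoints R φ 2) < heightForm θ (cuspPoints R φ 3) := by
  show heightForm θ 0 < heightForm θ (polarPoint R _)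
  rw [heightForm_polarPoint, map_zero, h, Real.sin_pi_div_two]
  linarith

theorem strictMono_proj_cuspPoints (hR : 0 < R) (h0 : -(Real.pi / 6) < φ - θ) (h1 : φ - θ < 0) :
    StrictMono fun j => proj θ (cuspPoints R φ j) := by
  have hpi := Real.pi_pos
  rw [Fin.strictMono_iff_lt_succ]
  intro i
  fin_cases i
  · exact proj_cuspPoints_zero_lt_one hR (by linarith) (by linarith)
  · exact (proj_cuspPoints_one_lt hR h0 (by linarith)).1
  · exact proj_cuspPoints_two_lt_three hR (by linarith) (by linarith)

end Order

/-! ### The rotation by `2π/3` as a braid -/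

theorem cuspPoints_injective {R : ℝ} (hR : 0 < R) (φ : ℝ) :
    Function.Injective (cuspPoints R φ) := by
  have hpi := Real.pi_pos
  -- Any direction with `φ - θ` in `(-π/6, 0)` separates the points; `-π/12` is the middle of that
  -- interval.
  have := (strictMono_proj_cuspPoints (φ := φ) (θ := φ + Real.pi / 12) hR (by linarith)
    (by linarith)).injective
  exact Function.Injective.of_comp (f := proj (φ + Real.pi / 12)) this

/-- The configuration of the points `cuspPoints R φ`, as a continuous function of `φ`. -/
noncomputable def cuspConf {R : ℝ} (hR : 0 < R) : C(ℝ, Conf 4) where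
  toFun φ := OrdConf.toConf ⟨cuspPoints R φ, cuspPoints_injective hR φ⟩
  continuous_toFun := (continuous_toConf 4).comp ((continuous_cuspPoints R).subtype_mk _)

theorem cuspConf_add {R : ℝ} (hR : 0 < R) (φ : ℝ) :
    cuspConf hR (φ + 2 * Real.pi / 3) = cuspConf hR φ :=
  Subtype.ext (range_cuspPoints_add R φ)

/-- The affine path from `a` to `b` in the real line. -/
noncomputable def linePath (a b : ℝ) : Path a b where
  toFun t := a + (b - a) * t
  continuous_toFun := by fun_prop
  source' := by simp
  target' := by simp

theorem linePath_apply (a b : ℝ) (t : unitInterval) : linePath a b t = a + (b - a) * t := rfl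

/-- The loop of configurations obtained by rotating the triangle by `2 π / 3`. -/
noncomputable def cuspRotation {R : ℝ} (hR : 0 < R) {s : Conf 4} (hs : s = cuspConf hR 0) :
    Path s s :=
  ((linePath 0 (2 * Real.pi / 3)).map (cuspConf hR).continuous).cast hs
    (hs.trans (by rw [← cuspConf_add, zero_add]))

theorem isGenericAngle_cuspConf {R : ℝ} (hR : 0 < R) {s : Conf 4} (hs : s = cuspConf hR 0)
    {θ : ℝ} (h0 : 0 < θ) (h1 : θ < Real.pi / 6) : IsGenericAngle θ s := by
  subst hs
  have hm := strictMono_proj_cuspPoints (φ := 0) (θ := θ) hR (by linarith) (by linarith)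
  rintro _ ⟨a, rfl⟩ _ ⟨b, rfl⟩ hab
  rw [hm.injective hab]

/-- `enum` is obtained by choice, but two strictly increasing sequences with the same range
coincide, and the projection is injective on `s`. -/
theorem enum_cuspConf {R : ℝ} (hR : 0 < R) {s : Conf 4} (hs : s = cuspConf hR 0)
    {θ : ℝ} (h0 : 0 < θ) (h1 : θ < Real.pi / 6) (h : IsGenericAngle θ s) :
    enum h = cuspPoints R 0 := by
  subst hs
  have hm := strictMono_proj_cuspPoints (φ := 0) (θ := θ) hR (by linarith) (by linarith)
  have hr : range (enum h) = range (cuspPoints R 0) := range_enum h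
  have : (fun j => proj θ (enum h j)) = fun j => proj θ (cuspPoints R 0 j) := by
    rw [← (strictMono_enum h).range_inj hm]
    exact (range_comp (proj θ) (enum h)).trans
      ((congrArg (image (proj θ)) hr).trans (range_comp (proj θ) (cuspPoints R 0)).symm)
  funext j
  refine h ?_ ?_ (congrFun this j)
  · rw [← range_enum h]; exact mem_range_self j
  · rw [← range_enum h, hr]; exact mem_range_self j

/-- Half-twists are described by positions, the rotating points by labels. Here `π` sends a label to
its position at the start of the half-twist and `σ` sends a position back to its label, so the order
conditions can be checked by position. -/
theorem segment_strandPath_subset_injective {R θ : ℝ} {p : Fin 4 → ℂ}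
    (hp : StrictMono fun j => proj θ (p j)) {φ : ℝ} {i : Fin 3} {π π' : Fin 4 → Fin 4}
    (h : ∀ j, Equiv.swap i.castSucc i.succ (π j) = π' j) (σ : Fin 4 → Fin 4)
    (hσ : ∀ j, σ (π j) = j) {t : unitInterval}
    (hq : ∀ a b, a < b → ¬(a = i.castSucc ∧ b = i.succ) →
      proj θ (cuspPoints R φ (σ a)) < proj θ (cuspPoints R φ (σ b)))
    (hlt : (t : ℝ) < 1 / 2 → proj θ (cuspPoints R φ (σ i.castSucc)) <
      proj θ (cuspPoints R φ (σ i.succ)))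
    (heq : (t : ℝ) = 1 / 2 → heightForm θ (cuspPoints R φ (σ i.castSucc)) <
      heightForm θ (cuspPoints R φ (σ i.succ)))
    (hgt : 1 / 2 < (t : ℝ) → proj θ (cuspPoints R φ (σ i.succ)) <
      proj θ (cuspPoints R φ (σ i.castSucc))) :
    segment ℝ (strandPath θ p i π π' h t) (cuspPoints R φ) ⊆ {f | Function.Injective f} := by
  have h1 := segment_comp_subset_injective (Function.LeftInverse.injective hσ)
    (segment_halfTwistFun_subset_injective hp (q := cuspPoints R φ ∘ σ) t.2 hq hlt heq hgt)
  rwa [Function.comp_assoc, (funext hσ : σ ∘ π = id), Function.comp_id] at h1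

theorem forall_fin_four_pairs {P : Fin 4 → Fin 4 → Prop} (h01 : P 0 1) (h02 : P 0 2)
    (h03 : P 0 3) (h12 : P 1 2) (h13 : P 1 3) (h23 : P 2 3) : ∀ a b, a < b → P a b := by
  intro a b hab
  fin_cases a <;> fin_cases b <;> first | assumption | exact absurd hab (by decide)

theorem loopClass_cuspRotation {R : ℝ} (hR : 0 < R) {s : Conf (3 + 1)} (hs : s = cuspConf hR 0)
    {θ : ℝ} (h0 : 0 < θ) (h1 : θ < Real.pi / 6) (h : IsGenericAngle θ s) :
    loopClass (cuspRotation hR hs) =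
      artinGenerator h 0 * artinGenerator h 1 * artinGenerator h 2 * artinGenerator h 1 := by
  have hpi := Real.pi_pos
  let p := enum h
  have hpe : p = cuspPoints R 0 := enum_cuspConf hR hs h0 h1 h
  have hp : StrictMono fun j => proj θ (p j) := strictMono_enum h
  -- The cut points make each interval symmetric about its crossing angle (`θ`, `θ + π/6`, `θ +
  -- π/3`, `θ + π/2`), so every crossing occurs at half time, as in a half-twist.
  let φ₁ := linePath 0 (2 * θ)
  let φ₂ := linePath (2 * θ) (Real.pi / 3)
  let φ₃ := linePath (Real.pi / 3) (Real.pi / 3 + 2 * θ)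
  let φ₄ := linePath (Real.pi / 3 + 2 * θ) (2 * Real.pi / 3)
  let φ := ((φ₁.trans φ₂).trans φ₃).trans φ₄
  -- Strand `0` moves through positions `0, 1, 2, 3`; then strands `2` and `3` exchange positions
  -- `1` and `2`.
  let u₁ := strandPath θ p 0 ![0, 1, 2, 3] ![1, 0, 2, 3] (by decide)
  let u₂ := strandPath θ p 1 ![1, 0, 2, 3] ![2, 0, 1, 3] (by decide)
  let u₃ := strandPath θ p 2 ![2, 0, 1, 3] ![3, 0, 1, 2] (by decide)
  let u₄ := strandPath θ p 1 ![3, 0, 1, 2] ![3, 0, 2, 1] (by decide)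
  let u := ((u₁.trans u₂).trans u₃).trans u₄
  let γ := (((halfTwist h 0).trans (halfTwist h 1)).trans (halfTwist h 2)).trans (halfTwist h 1)
  have hγ : ∀ t, (γ t).1 = range (u t) := by
    refine forall_trans_apply (P := fun (a : Conf 4) b => a.1 = range b) (forall_trans_apply
      (P := fun (a : Conf 4) b => a.1 = range b) (forall_trans_apply
      (P := fun (a : Conf 4) b => a.1 = range b) ?_ ?_) ?_) ?_
    all_goals exact range_strandPath h _ _ _ _ (by decide)
  let P : (Fin 4 → ℂ) → ℝ → Prop := fun f x =>
    segment ℝ f (cuspPoints R x) ⊆ {f | Function.Injective f}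
  have hu : ∀ t, P (u t) (φ t) := by
    refine forall_trans_apply (forall_trans_apply (forall_trans_apply ?_ ?_) ?_) ?_
    all_goals intro t; have ht0 : (0 : ℝ) ≤ t := t.2.1; have ht1 : (t : ℝ) ≤ 1 := t.2.2
    · have hφ := linePath_apply 0 (2 * θ) t
      have hl : 0 ≤ φ₁ t := by rw [hφ]; nlinarith
      have hr : φ₁ t ≤ 2 * θ := by rw [hφ]; nlinarith
      have h12 := proj_cuspPoints_one_lt (φ := φ₁ t) (θ := θ) hR (by linarith) (by linarith)
      refine segment_strandPath_subset_injective hp _ ![0, 1, 2, 3] (by decide)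
        (forall_fin_four_pairs ?_ ?_ ?_ ?_ ?_ ?_) ?_ ?_ ?_
      · exact fun hc => absurd ⟨rfl, rfl⟩ hc
      · exact fun _ => proj_cuspPoints_zero_lt_two hR (by linarith) (by linarith)
      · exact fun _ => proj_cuspPoints_zero_lt_three hR (by linarith) (by linarith)
      · exact fun _ => h12.1
      · exact fun _ => h12.2
      · exact fun _ => proj_cuspPoints_two_lt_three hR (by linarith) (by linarith)
      · exact fun ht => proj_cuspPoints_zero_lt_one hR (by linarith) (by rw [hφ]; nlinarith)
      · exact fun ht => height_cuspPoints_zero_lt_one hR (by rw [hφ, ht]; ring)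
      · exact fun ht => proj_cuspPoints_one_lt_zero hR (by rw [hφ]; nlinarith) (by linarith)
    · have hφ := linePath_apply (2 * θ) (Real.pi / 3) t
      have hl : 2 * θ ≤ φ₂ t := by rw [hφ]; nlinarith
      have hr : φ₂ t ≤ Real.pi / 3 := by rw [hφ]; nlinarith
      have h12 := proj_cuspPoints_one_lt (φ := φ₂ t) (θ := θ) hR (by linarith) (by linarith)
      refine segment_strandPath_subset_injective hp _ ![1, 0, 2, 3] (by decide)
        (forall_fin_four_pairs ?_ ?_ ?_ ?_ ?_ ?_) ?_ ?_ ?_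
      · exact fun _ => proj_cuspPoints_one_lt_zero hR (by linarith) (by linarith)
      · exact fun _ => h12.1
      · exact fun _ => h12.2
      · exact fun hc => absurd ⟨rfl, rfl⟩ hc
      · exact fun _ => proj_cuspPoints_zero_lt_three hR (by linarith) (by linarith)
      · exact fun _ => proj_cuspPoints_two_lt_three hR (by linarith) (by linarith)
      · exact fun ht => proj_cuspPoints_zero_lt_two hR (by linarith) (by rw [hφ]; nlinarith)
      · exact fun ht => height_cuspPoints_zero_lt_two hR (by rw [hφ, ht]; ring)
      · exact fun ht => proj_cuspPoints_two_lt_zero hR (by rw [hφ]; nlinarith) (by linarith)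
    · have hφ := linePath_apply (Real.pi / 3) (Real.pi / 3 + 2 * θ) t
      have hl : Real.pi / 3 ≤ φ₃ t := by rw [hφ]; nlinarith
      have hr : φ₃ t ≤ Real.pi / 3 + 2 * θ := by rw [hφ]; nlinarith
      have h12 := proj_cuspPoints_one_lt (φ := φ₃ t) (θ := θ) hR (by linarith) (by linarith)
      refine segment_strandPath_subset_injective hp _ ![1, 2, 0, 3] (by decide)
        (forall_fin_four_pairs ?_ ?_ ?_ ?_ ?_ ?_) ?_ ?_ ?_
      · exact fun _ => h12.1
      · exact fun _ => proj_cuspPoints_one_lt_zero hR (by linarith) (by linarith)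
      · exact fun _ => h12.2
      · exact fun _ => proj_cuspPoints_two_lt_zero hR (by linarith) (by linarith)
      · exact fun _ => proj_cuspPoints_two_lt_three hR (by linarith) (by linarith)
      · exact fun hc => absurd ⟨rfl, rfl⟩ hc
      · exact fun ht => proj_cuspPoints_zero_lt_three hR (by linarith) (by rw [hφ]; nlinarith)
      · exact fun ht => height_cuspPoints_zero_lt_three hR (by rw [hφ, ht]; ring)
      · exact fun ht => proj_cuspPoints_three_lt_zero hR (by rw [hφ]; nlinarith) (by linarith)
    · have hφ := linePath_apply (Real.pi / 3 + 2 * θ) (2 * Real.pi / 3) t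
      have hl : Real.pi / 3 + 2 * θ ≤ φ₄ t := by rw [hφ]; nlinarith
      have hr : φ₄ t ≤ 2 * Real.pi / 3 := by rw [hφ]; nlinarith
      have h12 := proj_cuspPoints_one_lt (φ := φ₄ t) (θ := θ) hR (by linarith) (by linarith)
      refine segment_strandPath_subset_injective hp _ ![1, 2, 3, 0] (by decide)
        (forall_fin_four_pairs ?_ ?_ ?_ ?_ ?_ ?_) ?_ ?_ ?_
      · exact fun _ => h12.1
      · exact fun _ => h12.2
      · exact fun _ => proj_cuspPoints_one_lt_zero hR (by linarith) (by linarith)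
      · exact fun hc => absurd ⟨rfl, rfl⟩ hc
      · exact fun _ => proj_cuspPoints_two_lt_zero hR (by linarith) (by linarith)
      · exact fun _ => proj_cuspPoints_three_lt_zero hR (by linarith) (by linarith)
      · exact fun ht => proj_cuspPoints_two_lt_three hR (by linarith) (by rw [hφ]; nlinarith)
      · exact fun ht => height_cuspPoints_two_lt_three hR (by rw [hφ, ht]; ring)
      · exact fun ht => proj_cuspPoints_three_lt_two hR (by rw [hφ]; nlinarith) (by linarith)
  let δ : Path s s := (φ.map (cuspConf hR).continuous).cast hs
    (hs.trans (by rw [← cuspConf_add, zero_add]))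
  have hγδ : γ.Homotopic δ := by
    refine homotopic_of_segment_subset (U := {f : Fin 4 → ℂ | Function.Injective f})
      ⟨fun f => OrdConf.toConf f, continuous_toConf 4⟩ (u := u) (v := fun t => cuspPoints R (φ t))
      u.continuous ((continuous_cuspPoints R).comp φ.continuous) hu ?_ ?_ ?_ ?_
    · rw [u.source, φ.source, hpe]
      funext j; fin_cases j <;> rfl
    -- The final labelling `![3, 0, 2, 1]` is the permutation by which a rotation by `2π/3` acts on
    -- the points.
    · rw [u.target, φ.target, hpe, ← zero_add (2 * Real.pi / 3), cuspPoints_add]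
    · exact fun t => Subtype.ext (hγ t)
    · exact fun t => rfl
  -- Both loops are images of paths in the real line with the same ends, which are homotopic by
  -- convexity.
  have hδ : (cuspRotation hR hs).Homotopic δ := by
    refine homotopic_of_segment_subset (U := univ)
      ⟨fun x => cuspConf hR x.1, (cuspConf hR).continuous.comp continuous_subtype_val⟩
      (linePath 0 (2 * Real.pi / 3)).continuous φ.continuous (fun _ => subset_univ _) ?_ ?_
      (fun t => rfl) (fun t => rfl)
    · rw [φ.source, Path.source]
    · rw [φ.target, Path.target]
  exact (loopClass_eq (hδ.trans hγδ.symm)).trans rfl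

/-! ### The fibres of the curve -/

theorem polarPoint_pow (R a : ℝ) (n : ℕ) : polarPoint R a ^ n = polarPoint (R ^ n) (n * a) := by
  rw [polarPoint, polarPoint, mul_pow, ← Complex.exp_nat_mul]
  push_cast
  ring_nf

theorem polarPoint_norm_arg (x : ℂ) : polarPoint ‖x‖ x.arg = x := Complex.norm_mul_exp_arg_mul_I x

theorem mem_fiber_cuspLine {x y : ℂ} : y ∈ fiber cuspLine x ↔ y * (y ^ 3 - x ^ 2) = 0 := by
  simp [fiber, cuspLine, evalEval]

theorem cuspPoints_mem_fiber {R r : ℝ} (h : R ^ 3 = r ^ 2) (a : ℝ) (j : Fin 4) :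
    cuspPoints R (2 * a / 3) j ∈ fiber cuspLine (polarPoint r a) := by
  have key : ∀ b : ℝ, (∃ k : ℕ, 3 * b = 2 * a + k * (2 * Real.pi)) →
      polarPoint R b ∈ fiber cuspLine (polarPoint r a) := by
    -- Cubing triples the argument, so `k` counts the full turns by which `3b` exceeds `2a`.
    rintro b ⟨k, hk⟩
    have hper : polarPoint (r ^ 2) (2 * a + k * (2 * Real.pi)) = polarPoint (r ^ 2) (2 * a) :=
      Function.Periodic.nat_mul (polarPoint_add_two_pi (r ^ 2)) k (2 * a)
    rw [mem_fiber_cuspLine, polarPoint_pow, polarPoint_pow, h]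
    push_cast
    rw [hk, hper, sub_self, mul_zero]
  fin_cases j
  · exact key _ ⟨2, by push_cast; ring⟩
  · exact key _ ⟨1, by push_cast; ring⟩
  · exact mem_fiber_cuspLine.2 (zero_mul _)
  · exact key _ ⟨0, by push_cast; ring⟩

theorem encard_range_cuspPoints {R : ℝ} (hR : 0 < R) (φ : ℝ) :
    (range (cuspPoints R φ)).encard = 4 := by
  rw [← image_univ, (cuspPoints_injective hR φ).encard_image]
  simp

theorem polarPoint_notMem_branchSet {R r : ℝ} (hR : 0 < R) (h : R ^ 3 = r ^ 2) (a : ℝ) :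
    polarPoint r a ∉ branchSet cuspLine := by
  rw [branchSet, mem_ofPred_eq, not_lt, cuspLine_natDegree]
  exact (encard_range_cuspPoints hR (2 * a / 3)).symm.le.trans
    (encard_le_encard (range_subset_iff.2 (cuspPoints_mem_fiber h a)))

/-- Four distinct roots are already known, and the degree in `y` allows no more. -/
theorem fiber_cuspLine_polarPoint {R r : ℝ} (hR : 0 < R) (h : R ^ 3 = r ^ 2) (a : ℝ) :
    fiber cuspLine (polarPoint r a) = range (cuspPoints R (2 * a / 3)) := by
  have h4 := encard_fiber cuspLine_monic (polarPoint_notMem_branchSet hR h a)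
  refine ((finite_range _).eq_of_subset_of_encard_le
    (range_subset_iff.2 (cuspPoints_mem_fiber h a)) ?_).symm
  rw [h4, encard_range_cuspPoints hR, cuspLine_natDegree]
  rfl

theorem exists_cube_eq_sq {r : ℝ} (hr : 0 < r) : ∃ R : ℝ, 0 < R ∧ R ^ 3 = r ^ 2 := by
  refine ⟨(r ^ 2) ^ (3⁻¹ : ℝ), by positivity, ?_⟩
  exact_mod_cast Real.rpow_inv_natCast_pow (n := 3) (by positivity : (0 : ℝ) ≤ r ^ 2) (by norm_num)

theorem branchSet_cuspLine : branchSet cuspLine = {0} := by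
  ext x
  rw [mem_singleton_iff]
  constructor
  · intro hx
    by_contra hne
    obtain ⟨R, hR, h⟩ := exists_cube_eq_sq (norm_pos_iff.2 hne)
    exact polarPoint_notMem_branchSet hR h x.arg (by rwa [polarPoint_norm_arg])
  · rintro rfl
    have : fiber cuspLine 0 = {0} := by
      ext y
      rw [mem_fiber_cuspLine, mem_singleton_iff]
      simp
    rw [branchSet, mem_ofPred_eq, this, encard_singleton, cuspLine_natDegree]
    norm_num

/-! ### The fundamental group of a punctured disk -/

section PuncturedDisk

variable {r : ℝ} {N : Set ℂ} {M : ↥(Metric.closedBall (0 : ℂ) r \ N)}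

/-- A loop in a punctured disk of radius `r` that has a logarithm ending at `2 π i n` is homotopic
to the `n`-th power of the boundary circle. -/
theorem loopClass_eq_zpow (hr : 0 < r) (hN : N = {0}) {Γ : Path M M}
    (hΓ : ∀ t : unitInterval, (Γ t : ℂ) = r * Complex.exp (2 * Real.pi * Complex.I * (t : ℝ)))
    (n : ℤ) : ∀ (γ : Path M M) (g : Path (0 : ℂ) (n * (2 * Real.pi * Complex.I))),
      (∀ t, (γ t : ℂ) = r * Complex.exp (g t)) → loopClass γ = loopClass Γ ^ n := by
  have hr' : (r : ℂ) ≠ 0 := by exact_mod_cast hr.ne'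
  induction n using Int.induction_on with
  | zero =>
    intro γ g hg
    rw [zpow_zero, ← loopClass_refl M]
    have hM : (M : ℂ) = r := by
      have := hg 0
      rwa [γ.source, g.source, Complex.exp_zero, mul_one] at this
    -- In logarithmic coordinates the punctured disk becomes the half-plane `Re w ≤ 0`. It is
    -- convex, so a closed logarithm contracts linearly to `0`.
    have hconv : Convex ℝ {w : ℂ | w.re ≤ 0} := convex_halfSpace_re_le 0
    have hmem : ∀ w : {w : ℂ | w.re ≤ 0},
        (r : ℂ) * Complex.exp w ∈ Metric.closedBall (0 : ℂ) r \ N := by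
      rintro ⟨w, hw⟩
      refine ⟨?_, by rw [hN]; exact mul_ne_zero hr' (Complex.exp_ne_zero _)⟩
      rw [mem_closedBall_zero_iff, norm_mul, Complex.norm_real, Real.norm_of_nonneg hr.le,
        Complex.norm_exp]
      exact mul_le_of_le_one_right hr.le (Real.exp_le_one_iff.2 hw)
    have hgre : ∀ t, (g t).re ≤ 0 := by
      intro t
      have h1 := mem_closedBall_zero_iff.1 (γ t).2.1
      rw [hg, norm_mul, Complex.norm_real, Real.norm_of_nonneg hr.le, Complex.norm_exp] at h1
      exact Real.exp_le_one_iff.1 (le_of_mul_le_mul_left (by rwa [mul_one]) hr)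
    refine loopClass_eq (homotopic_of_segment_subset (U := {w : ℂ | w.re ≤ 0})
      ⟨fun w => ⟨(r : ℂ) * Complex.exp w, hmem w⟩, by fun_prop⟩ (u := g) (v := fun _ => 0)
      g.continuous continuous_const
      (fun t => hconv.segment_subset (hgre t) (le_refl (0 : ℝ))) g.source (g.target.trans (by simp))
      (fun t => Subtype.ext (hg t)) fun t => Subtype.ext ?_)
    simp [hM]
  | succ n ih =>
    intro γ g hg
    let b : Path (((n + 1 : ℤ) : ℂ) * (2 * Real.pi * Complex.I))
        (((n : ℤ) : ℂ) * (2 * Real.pi * Complex.I)) :=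
      { toFun := fun t => ((n + 1 : ℤ) - (t : ℝ)) * (2 * Real.pi * Complex.I)
        continuous_toFun := by fun_prop
        source' := by simp
        target' := by simp }
    -- Appending the reversed circle lowers the end of the logarithm by `2πi`, which reduces to the
    -- case `n`.
    have h := ih (γ.trans Γ.symm) (g.trans b)
      (forall_trans_apply (P := fun (x : ↥(Metric.closedBall (0 : ℂ) r \ N)) w =>
        (x : ℂ) = r * Complex.exp w) hg fun t => ?_)
    · rw [loopClass_trans, loopClass_symm, mul_inv_eq_iff_eq_mul] at h
      rw [h, zpow_add_one]
    · show (Γ (unitInterval.symm t) : ℂ) =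
        r * Complex.exp (((n + 1 : ℤ) - (t : ℝ)) * (2 * Real.pi * Complex.I))
      rw [hΓ, ← (Complex.exp_periodic.int_mul n) (2 * Real.pi * Complex.I * _)]
      congr 2
      rw [unitInterval.coe_symm_eq]
      push_cast
      ring
  | pred n ih =>
    intro γ g hg
    let b : Path (((-n - 1 : ℤ) : ℂ) * (2 * Real.pi * Complex.I))
        (((-n : ℤ) : ℂ) * (2 * Real.pi * Complex.I)) :=
      { toFun := fun t => ((-n - 1 : ℤ) + (t : ℝ)) * (2 * Real.pi * Complex.I)
        continuous_toFun := by fun_prop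
        source' := by simp
        target' := by simp }
    have h := ih (γ.trans Γ) (g.trans b)
      (forall_trans_apply (P := fun (x : ↥(Metric.closedBall (0 : ℂ) r \ N)) w =>
        (x : ℂ) = r * Complex.exp w) hg fun t => ?_)
    · rw [loopClass_trans, ← eq_mul_inv_iff_mul_eq] at h
      rw [h, zpow_sub_one]
    · show (Γ t : ℂ) = r * Complex.exp (((-n - 1 : ℤ) + (t : ℝ)) * (2 * Real.pi * Complex.I))
      rw [hΓ, ← (Complex.exp_periodic.int_mul (-n - 1)) (2 * Real.pi * Complex.I * _)]
      congr 2
      push_cast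
      ring

/-- The exponential is a covering of the punctured plane, so `γ / r` lifts to a path from `0`; its
end is a logarithm of `1`. -/
theorem exists_log_path (hr : 0 < r) (hN : N = {0}) (hM : (M : ℂ) = r) (γ : Path M M) :
    ∃ (n : ℤ) (g : Path (0 : ℂ) (n * (2 * Real.pi * Complex.I))),
      ∀ t, (γ t : ℂ) = r * Complex.exp (g t) := by
  have hr' : (r : ℂ) ≠ 0 := by exact_mod_cast hr.ne'
  have hne : ∀ t, (γ t : ℂ) / r ≠ 0 := fun t => div_ne_zero (by
    have h0 : (0 : ℂ) ∈ N := by simp [hN]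
    exact fun h => (γ t).2.2 (by rwa [h])) hr'
  let f : C(unitInterval, {z : ℂ // z ≠ 0}) :=
    ⟨fun t => ⟨(γ t : ℂ) / r, hne t⟩, by
      refine Continuous.subtype_mk ?_ _
      exact (continuous_subtype_val.comp γ.continuous).div_const _⟩
  obtain ⟨G, hG, hG0⟩ := Complex.isCoveringMap_exp.exists_path_lifts f 0
    (Subtype.ext (by simp [f, hM, hr']))
  have hG' : ∀ t, (γ t : ℂ) = r * Complex.exp (G t) := by
    intro t
    have h1 : Complex.exp (G t) = γ t / r := congrArg Subtype.val (congrFun hG t)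
    rw [h1]
    field_simp
  have h1 : Complex.exp (G 1) = 1 := by
    have := hG' 1
    rw [γ.target, hM] at this
    exact (mul_right_eq_self₀.1 this.symm).resolve_right hr'
  obtain ⟨n, hn⟩ := Complex.exp_eq_one_iff.1 h1
  exact ⟨n, ⟨G, hG0, hn⟩, hG'⟩

theorem zpowers_loopClass_eq_top (hr : 0 < r) (hN : N = {0}) (hM : (M : ℂ) = r) {Γ : Path M M}
    (hΓ : ∀ t : unitInterval, (Γ t : ℂ) = r * Complex.exp (2 * Real.pi * Complex.I * (t : ℝ))) :
    Subgroup.zpowers (loopClass Γ) = ⊤ := by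
  refine (Subgroup.eq_top_iff' _).2 fun x => ?_
  obtain ⟨γ, rfl⟩ := exists_loopClass_eq x
  obtain ⟨n, g, hg⟩ := exists_log_path hr hN hM γ
  exact ⟨n, (loopClass_eq_zpow hr hN hΓ n γ g hg).symm⟩

end PuncturedDisk

/-! ### The local braid monodromy -/

theorem map_fiberMap_eq_trans {R r : ℝ} (hR : 0 < R) (h : R ^ 3 = r ^ 2)
    {M : ↥(Metric.closedBall (0 : ℂ) r \ branchSet cuspLine)} {Γ : Path M M}
    (hΓ : ∀ t : unitInterval, (Γ t : ℂ) = r * Complex.exp (2 * Real.pi * Complex.I * (t : ℝ)))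
    (hs : fiberMap cuspLine_monic cuspLine_natDegree (Metric.closedBall (0 : ℂ) r) M =
      cuspConf hR 0) :
    Γ.map (fiberMap cuspLine_monic cuspLine_natDegree (Metric.closedBall (0 : ℂ) r)).continuous =
      (cuspRotation hR hs).trans (cuspRotation hR hs) := by
  have hL : ∀ t : unitInterval,
      fiberMap cuspLine_monic cuspLine_natDegree (Metric.closedBall (0 : ℂ) r) (Γ t) =
        cuspConf hR (2 * (2 * Real.pi * t) / 3) := by
    intro t
    refine Subtype.ext ?_
    show fiber cuspLine (Γ t) = range (cuspPoints R _)
    rw [← fiber_cuspLine_polarPoint hR h, hΓ, polarPoint]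
    push_cast
    ring_nf
  have hρ : ∀ t : unitInterval, cuspRotation hR hs t = cuspConf hR (2 * Real.pi / 3 * t) := by
    intro t
    show cuspConf hR (0 + (2 * Real.pi / 3 - 0) * t) = _
    rw [zero_add, sub_zero]
  ext1
  funext t
  rw [Path.trans_apply]
  refine (hL t).trans ?_
  split_ifs with ht
  · rw [hρ]
    congr 1
    show _ = 2 * Real.pi / 3 * (2 * (t : ℝ))
    ring
  -- On the second half the angle is ahead by `2π/3`, which does not change the configuration.
  · rw [hρ, ← cuspConf_add hR (2 * Real.pi / 3 * _)]
    congr 1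
    show _ = 2 * Real.pi / 3 * (2 * (t : ℝ) - 1) + _
    ring

end BraidMonodromy

open BraidMonodromy
theorem mainTheorem11 (r : ℝ) (hr : 0 < r) :
    branchSet cuspLine = {0} ∧
    ∃ (M : ↥(Metric.closedBall (0 : ℂ) r \ branchSet cuspLine)) (Γ : Path M M),
      (M : ℂ) = r ∧
      (∀ t : unitInterval, (Γ t : ℂ) = r * Complex.exp (2 * Real.pi * Complex.I * (t : ℝ))) ∧
      ∀ᶠ θ : ℝ in 𝓝[>] 0,
        ∃ h : IsGenericAngle (n := 3 + 1) θ
            (fiberMap cuspLine_monic cuspLine_natDegree (Metric.closedBall (0 : ℂ) r) M),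
          braidMonodromy cuspLine_monic cuspLine_natDegree (Metric.closedBall (0 : ℂ) r) M
              (loopClass Γ) =
            (artinGenerator h 0 * artinGenerator h 1 * artinGenerator h 2
              * artinGenerator h 1) ^ 2 ∧
          (braidMonodromy cuspLine_monic cuspLine_natDegree
              (Metric.closedBall (0 : ℂ) r) M).range =
            Subgroup.zpowers ((artinGenerator h 0 * artinGenerator h 1 * artinGenerator h 2
              * artinGenerator h 1) ^ 2) := by
  have hr' : (r : ℂ) ≠ 0 := by exact_mod_cast hr.ne'
  have hmem : ∀ w : ℂ, ‖w‖ = 1 →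
      (r : ℂ) * w ∈ Metric.closedBall (0 : ℂ) r \ branchSet cuspLine := by
    intro w hw
    refine ⟨?_, ?_⟩
    · rw [mem_closedBall_zero_iff, norm_mul, hw, mul_one, Complex.norm_real,
        Real.norm_of_nonneg hr.le]
    · rw [branchSet_cuspLine]
      exact mul_ne_zero hr' (norm_ne_zero_iff.1 (by rw [hw]; exact one_ne_zero))
  let M : ↥(Metric.closedBall (0 : ℂ) r \ branchSet cuspLine) :=
    ⟨r, by simpa using hmem 1 norm_one⟩
  let Γ : Path M M :=
    { toFun := fun t => ⟨r * Complex.exp (2 * Real.pi * Complex.I * (t : ℝ)), hmem _ (by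
        rw [Complex.norm_exp]; simp)⟩
      continuous_toFun := by fun_prop
      source' := Subtype.ext (by simp [M])
      target' := Subtype.ext (by simp [M]) }
  have hΓ : ∀ t : unitInterval,
      (Γ t : ℂ) = r * Complex.exp (2 * Real.pi * Complex.I * (t : ℝ)) := fun _ => rfl
  refine ⟨branchSet_cuspLine, M, Γ, rfl, hΓ, ?_⟩
  obtain ⟨R, hR, hRr⟩ := exists_cube_eq_sq hr
  have hs : fiberMap cuspLine_monic cuspLine_natDegree (Metric.closedBall (0 : ℂ) r) M =
      cuspConf hR 0 := by
    refine Subtype.ext ?_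
    have := fiber_cuspLine_polarPoint hR hRr 0
    rw [show polarPoint r 0 = r by simp [polarPoint], mul_zero, zero_div] at this
    exact this
  -- At `θ = 0` the two left vertices are aligned, and at `θ = π/6` the upper one is aligned with
  -- the centre; in between the order is constant.
  filter_upwards [Ioo_mem_nhdsGT (show (0 : ℝ) < Real.pi / 6 by positivity)] with θ hθ
  have h := isGenericAngle_cuspConf hR hs hθ.1 hθ.2
  have himage : braidMonodromy cuspLine_monic cuspLine_natDegree (Metric.closedBall (0 : ℂ) r) M
      (loopClass Γ) = (artinGenerator h 0 * artinGenerator h 1 * artinGenerator h 2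
        * artinGenerator h 1) ^ 2 := by
    rw [braidMonodromy, Pi1.map_loopClass, map_fiberMap_eq_trans hR hRr hΓ hs, loopClass_trans,
      ← sq, loopClass_cuspRotation hR hs hθ.1 hθ.2 h]
  refine ⟨h, himage, ?_⟩
  -- The source is generated by the circle, so the image is generated by the image of the circle.
  rw [MonoidHom.range_eq_map, ← zpowers_loopClass_eq_top hr branchSet_cuspLine rfl hΓ,
    MonoidHom.map_zpowers, himage]
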